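/- Let $P$ be a set of points in the plane and let $\mathcal R$ be a family of subsets of the plane. Let $H(P,\mathcal R)$ denote the incidence hypergraph with vertex set $P$ and edge set $\{P\cap R \mid R\in\mathcal R\}$. A hypergraph is a graph if each of its edges has exactly two vertices. Its chromatic number is the smallest number of colors in a coloring of its vertices with no monochromatic edge. For $n\ge 2$, an $n$-cycle of a hypergraph is a sequence $(v_1,E_1,v_2,E_2,\dots,v_n,E_n)$ of distinct vertices $v_1,\dots,v_n$ and distinct edges $E_1,\dots,E_n$ such that $v_n,v_1\in E_n$ and $v_i,v_{i+1}\in E_i$ for $i=1,\dots,n-1$. The girth is the length of a shortest cycle ($\infty$ if there is no cycle). An axis-parallel rectangle is a set of the form $\{(x,y)\mid x_1\le x\le x_2,\ y_1\le y\le y_2\}$ with $x_1,x_2,y_1,y_2\in\mathbb R$. Theorem. For all integers $c,g\ge 1$ there exist a finite set $P$ of points in the plane and a set $\mathcal R$ of axis-parallel rectangles such that $H(P,\mathcal R)$ is a graph, has girth at least $g$, and has chromatic number at least $c+1$. -/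

import Mathlib

namespace Hypergraph

/-- The incidence hypergraph of a point set `P` and a family `F` of sets:
the vertex set is `P` and the edges are the traces `P ∩ R` of the members `R` of `F`. -/
def incidence {α : Type*} (P : Set α) (F : Set (Set α)) : Hypergraph α where
  vertexSet := P
  edgeSet := {e | ∃ R ∈ F, e = P ∩ R}
  subset_vertexSet_of_mem_edgeSet' := by
    rintro e ⟨R, -, rfl⟩
    exact Set.inter_subset_left

/-- A hypergraph is a graph if every edge consists of exactly two vertices. -/
def IsGraph {α : Type*} (H : Hypergraph α) : Prop :=
  ∀ e ∈ H.edgeSet, e.ncard = 2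

/-- A set of vertices is monochromatic under a coloring of the vertices if
all its vertices receive the same color. -/
def IsMonochromatic {α κ : Type*} (H : Hypergraph α) (f : H.vertexSet → κ) (e : Set α) : Prop :=
  ∀ u v : H.vertexSet, (u : α) ∈ e → (v : α) ∈ e → f u = f v

/-- `H` has a proper coloring with `n` colors: one without monochromatic edges. -/
def Colorable {α : Type*} (H : Hypergraph α) (n : ℕ) : Prop :=
  ∃ f : H.vertexSet → Fin n, ∀ e ∈ H.edgeSet, ¬ H.IsMonochromatic f e

/-- The smallest number of colors in a proper coloring (`⊤` if there is no proper coloring with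
finitely many colors). -/
noncomputable def chromaticNumber {α : Type*} (H : Hypergraph α) : ℕ∞ :=
  ⨅ (n : ℕ) (_ : H.Colorable n), (n : ℕ∞)

/-- `(v 0, E 0, v 1, E 1, …, v (n - 1), E (n - 1))` is an `n`-cycle of `H`: `n ≥ 2`, the vertices
are distinct, the edges are distinct, and `E i` contains `v i` and the cyclically next vertex. -/
structure IsCycle {α : Type*} (H : Hypergraph α) (n : ℕ) (v : Fin n → α) (E : Fin n → Set α) :
    Prop where
  two_le : 2 ≤ n
  vertex_injective : Function.Injective v
  edge_injective : Function.Injective E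
  edge_mem : ∀ i, E i ∈ H.edgeSet
  mem_edge : ∀ i, v i ∈ E i
  next_mem_edge : ∀ i, v (finRotate n i) ∈ E i

/-- The length of a shortest cycle (`⊤` if there are no cycles). -/
noncomputable def girth {α : Type*} (H : Hypergraph α) : ℕ∞ :=
  ⨅ (n : ℕ) (v : Fin n → α) (E : Fin n → Set α) (_ : H.IsCycle n v E), (n : ℕ∞)

end Hypergraph

/-- Closed axis-parallel rectangles in the plane. -/
def IsAxisParallelRectangle (R : Set (ℝ × ℝ)) : Prop :=
  ∃ x₁ x₂ y₁ y₂ : ℝ, R = {p | x₁ ≤ p.1 ∧ p.1 ≤ x₂ ∧ y₁ ≤ p.2 ∧ p.2 ≤ y₂}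

/-! The induction is on the number `c` of colors. Let a planar point set `V` carry a graph without
proper `c`-coloring, whose edges have bounding boxes free of other points. Take a sparse hypergraph
with edges of size `|V|` that has a monochromatic edge in every `(c+1)`-coloring
(`exists_sparse_forcesMonochromatic`), and put its vertices on a horizontal line. For every
hyperedge add a copy of the graph, its points joined by pendant edges to the points of the
hyperedge. Over a hyperedge of color `k`, either some point of the copy has color `k` and its
pendant edge is monochromatic, or the copy uses only `c` colors. The boxes stay empty because each
copy has its own range of heights, keeps the left-to-right order of `V`, and lies closer to its base
points the higher it is.

Sparsity is phrased through leaves. A cycle has no leaf, and leaves survive gluing: a leaf copy is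
attached at one vertex at most, which spoils at most one of two leaves inside it.
`LocallyForest.amalgam` also gains one in girth over the gluing hypergraph. Hence the sparse
hypergraphs arise by induction on `g`, by gluing partite hypergraphs along one part at a time
(`exists_partite`). -/

/-! ### Leaves and amalgamation. -/

/-- The edge `e` of the family `A` shares at most one vertex with the other edges in `S`. -/
def IsLeaf {V E : Type} (A : E → Set V) (S : Finset E) (e : E) : Prop :=
  e ∈ S ∧ ∀ u ∈ A e, ∀ v ∈ A e, ∀ e₁ ∈ S, ∀ e₂ ∈ S, e₁ ≠ e → e₂ ≠ e → u ∈ A e₁ → v ∈ A e₂ → u = v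

/-- Any set of at least two and fewer than `g` edges has two leaves. This is a way of
saying that the girth is at least `g` without mentioning cycles. -/
def LocallyForest {V E : Type} (g : ℕ) (A : E → Set V) : Prop :=
  ∀ S : Finset E, 1 < S.card → S.card < g → ∃ e₁ e₂, e₁ ≠ e₂ ∧ IsLeaf A S e₁ ∧ IsLeaf A S e₂

/-- A leaf of the hypergraph of copies yields a leaf inside that copy, in an amalgam of copies
of `A` along `X`. -/
theorem exists_isLeaf_amalgam {V E W F K : Type} [DecidableEq E] [DecidableEq F] {g : ℕ}
    {A : E → Set V} {X : Set V}
    (hX : ∀ e, ∀ u ∈ A e, ∀ v ∈ A e, u ∈ X → v ∈ X → u = v)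
    (hA : LocallyForest g A) {ψ : F → V → W} (hψ : ∀ f, Set.InjOn (ψ f) X)
    {θ : F → V → K}
    (hθ' : ∀ f f' u v, f ≠ f' → θ f u = θ f' v → u ∈ X ∧ v ∈ X ∧ ψ f u = ψ f' v)
    (hθ : ∀ f, Function.Injective (θ f))
    {S : Finset (F × E)} (hS : S.card < g) {f : F} (hf : f ∈ S.image Prod.fst)
    (h : IsLeaf (fun f => ψ f '' X) (S.image Prod.fst) f ∨ ∀ e e', (f, e) ∈ S → (f, e') ∈ S → e = e') :
    ∃ e, IsLeaf (fun p : F × E => θ p.1 '' A p.2) S (f, e) := by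
  classical
  obtain ⟨⟨f₀, e⟩, he, hfe⟩ := Finset.mem_image.1 hf
  obtain rfl : f = f₀ := hfe.symm
  -- A lone edge of its copy meets other edges only inside `X`, so in at most one vertex.
  by_cases hs : ∀ e e', (f, e) ∈ S → (f, e') ∈ S → e = e'
  · refine ⟨e, he, ?_⟩
    rintro _ ⟨u, hu, rfl⟩ _ ⟨v, hv, rfl⟩ ⟨f₁, e₁⟩ h₁ ⟨f₂, e₂⟩ h₂ n₁ n₂ ⟨u', hu', eu⟩ ⟨v', hv', ev⟩
    have n₁' : f ≠ f₁ := by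
      rintro rfl
      exact n₁ (by rw [hs _ _ h₁ he])
    have n₂' : f ≠ f₂ := by
      rintro rfl
      exact n₂ (by rw [hs _ _ h₂ he])
    rw [hX e u hu v hv (hθ' _ _ _ _ n₁' eu.symm).1 (hθ' _ _ _ _ n₂' ev.symm).1]
  · have hl := h.resolve_right hs
    set Sf : Finset E := (S.filter fun p => p.1 = f).image Prod.snd with hSf
    have mem : ∀ e, e ∈ Sf ↔ (f, e) ∈ S := by
      intro e
      simp only [hSf, Finset.mem_image, Finset.mem_filter]
      constructor
      · rintro ⟨⟨a, b⟩, ⟨hp, ha⟩, hb⟩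
        rwa [← ha, ← hb]
      · intro h
        exact ⟨(f, e), ⟨h, rfl⟩, rfl⟩
    have c1 : 1 < Sf.card := by
      push Not at hs
      obtain ⟨a, b, ha, hb, hab⟩ := hs
      exact Finset.one_lt_card.2 ⟨a, (mem a).2 ha, b, (mem b).2 hb, hab⟩
    have c2 : Sf.card < g :=
      (Finset.card_image_le.trans (Finset.card_filter_le _ _)).trans_lt hS
    obtain ⟨e₁, e₂, hne, l₁, l₂⟩ := hA Sf c1 c2
    -- Since `f` is a leaf, its copy has at most one vertex in common with the other copies in `S`.
    have out : ∀ u v f₁ f₂ b₁ b₂ u' v', (f₁, b₁) ∈ S → (f₂, b₂) ∈ S → f₁ ≠ f → f₂ ≠ f →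
        θ f₁ u' = θ f u → θ f₂ v' = θ f v → u = v := by
      intro u v f₁ f₂ b₁ b₂ u' v' h₁ h₂ n₁ n₂ eu ev
      obtain ⟨xu', xu, pu⟩ := hθ' _ _ _ _ n₁ eu
      obtain ⟨xv', xv, pv⟩ := hθ' _ _ _ _ n₂ ev
      refine hψ f xu xv ?_
      exact hl.2 _ ⟨u, xu, rfl⟩ _ ⟨v, xv, rfl⟩ f₁ (Finset.mem_image_of_mem _ h₁) f₂
        (Finset.mem_image_of_mem _ h₂) n₁ n₂ ⟨u', xu', pu⟩ ⟨v', xv', pv⟩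
    have key : ∀ a, IsLeaf A Sf a → ¬ IsLeaf (fun p : F × E => θ p.1 '' A p.2) S (f, a) →
        ∃ u ∈ A a, ∃ v ∈ A a, u ≠ v ∧ (∃ b ∈ Sf, b ≠ a ∧ u ∈ A b) ∧
          ∃ f' b v', (f', b) ∈ S ∧ f' ≠ f ∧ θ f' v' = θ f v := by
      intro a la nl
      by_contra hcon
      refine nl ⟨(mem a).1 la.1, ?_⟩
      rintro _ ⟨u, hu, rfl⟩ _ ⟨v, hv, rfl⟩ ⟨f₁, e₁⟩ h₁ ⟨f₂, e₂⟩ h₂ n₁ n₂ ⟨u', hu', eu⟩ ⟨v', hv', ev⟩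
      by_contra huv
      have huv' : u ≠ v := fun h => huv (by rw [h])
      simp only at hu hv eu ev hu' hv'
      by_cases k₁ : f₁ = f <;> by_cases k₂ : f₂ = f
      · subst k₁
        subst k₂
        have := hθ _ eu
        have := hθ _ ev
        subst u' v'
        exact huv' (la.2 u hu v hv e₁ ((mem _).2 h₁) e₂ ((mem _).2 h₂)
          (fun h => n₁ (by rw [h])) (fun h => n₂ (by rw [h])) hu' hv')
      · subst k₁
        have := hθ _ eu
        subst u'
        exact hcon ⟨u, hu, v, hv, huv', ⟨e₁, (mem _).2 h₁, fun h => n₁ (by rw [h]), hu'⟩,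
          f₂, e₂, v', h₂, k₂, ev⟩
      · subst k₂
        have := hθ _ ev
        subst v'
        exact hcon ⟨v, hv, u, hu, huv'.symm, ⟨e₂, (mem _).2 h₂, fun h => n₂ (by rw [h]), hv'⟩,
          f₁, e₁, u', h₁, k₁, eu⟩
      · exact huv' (out u v f₁ f₂ e₁ e₂ u' v' h₁ h₂ k₁ k₂ eu ev)
    by_contra hno
    push Not at hno
    -- If both leaves are spoilt, both contain the attaching vertex `v`. Then `e₁` meets `e₂` in `v`
    -- and `b` in `u ≠ v`, so it was no leaf.
    obtain ⟨u, hu, v, hv, huv, ⟨b, hb, hba, hub⟩, f₁, b₁, z₁, h₁, k₁, ev⟩ := key e₁ l₁ (hno e₁)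
    obtain ⟨-, -, w, hw, -, -, f₂, b₂, z₂, h₂, k₂, ew⟩ := key e₂ l₂ (hno e₂)
    obtain rfl := out v w f₁ f₂ b₁ b₂ z₁ z₂ h₁ h₂ k₁ k₂ ev ew
    exact huv (l₁.2 u hu v hv b hb e₂ l₂.1 hba hne.symm hub hw)

/-- Amalgamating copies of `A` along the hyperedges of a hypergraph which is one step less sparse
than `A` keeps the sparsity of `A`, provided every edge of `A` has at most one vertex in the
amalgamated set `X`. -/
theorem LocallyForest.amalgam {V E W F K : Type} {g : ℕ} {A : E → Set V} {X : Set V}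
    (hX : ∀ e, ∀ u ∈ A e, ∀ v ∈ A e, u ∈ X → v ∈ X → u = v)
    (hA : LocallyForest (g + 1) A) {ψ : F → V → W} (hψ : ∀ f, Set.InjOn (ψ f) X)
    (hH : LocallyForest g (fun f => ψ f '' X)) {θ : F → V → K}
    (hθ' : ∀ f f' u v, f ≠ f' → θ f u = θ f' v → u ∈ X ∧ v ∈ X ∧ ψ f u = ψ f' v)
    (hθ : ∀ f, Function.Injective (θ f)) :
    LocallyForest (g + 1) (fun p : F × E => θ p.1 '' A p.2) := by
  classical
  intro S h1 h2
  set T := S.image Prod.fst with hT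
  have hTS : T.card ≤ S.card := Finset.card_image_le
  rcases Nat.lt_or_ge 1 T.card with hT1 | hT1
  · have two : ∃ f₁ f₂, f₁ ≠ f₂ ∧ f₁ ∈ T ∧ f₂ ∈ T ∧
        (IsLeaf (fun f => ψ f '' X) T f₁ ∨ ∀ e e', (f₁, e) ∈ S → (f₁, e') ∈ S → e = e') ∧
        (IsLeaf (fun f => ψ f '' X) T f₂ ∨ ∀ e e', (f₂, e) ∈ S → (f₂, e') ∈ S → e = e') := by
      rcases Nat.lt_or_ge T.card g with hg | hg
      · obtain ⟨f₁, f₂, hne, l₁, l₂⟩ := hH T hT1 hg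
        exact ⟨f₁, f₂, hne, l₁.1, l₂.1, Or.inl l₁, Or.inl l₂⟩
      -- The gain of one: `S` has at most `g` edges in at least `g` copies, hence one edge per copy,
      -- and sparsity of the gluing hypergraph is not needed.
      · have hinj : Set.InjOn Prod.fst (S : Set (F × E)) :=
          Finset.card_image_iff.1 (by rw [← hT]; omega)
        have hone : ∀ f e e', (f, e) ∈ S → (f, e') ∈ S → e = e' := fun f e e' h h' =>
          congrArg Prod.snd (hinj h h' rfl)
        obtain ⟨f₁, m₁, f₂, m₂, hne⟩ := Finset.one_lt_card.1 hT1
        exact ⟨f₁, f₂, hne, m₁, m₂, Or.inr (hone f₁), Or.inr (hone f₂)⟩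
    obtain ⟨f₁, f₂, hne, m₁, m₂, l₁, l₂⟩ := two
    obtain ⟨e₁, k₁⟩ := exists_isLeaf_amalgam hX hA hψ hθ' hθ h2 m₁ l₁
    obtain ⟨e₂, k₂⟩ := exists_isLeaf_amalgam hX hA hψ hθ' hθ h2 m₂ l₂
    exact ⟨_, _, fun h => hne (congrArg Prod.fst h), k₁, k₂⟩
  · obtain ⟨⟨f, e⟩, he⟩ := Finset.card_pos.1 (by omega : 0 < S.card)
    have hf : ∀ p ∈ S, p.1 = f := fun p hp =>
      Finset.card_le_one.1 hT1 _ (Finset.mem_image_of_mem _ hp) _ (Finset.mem_image_of_mem _ he)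
    have hcard : (S.image Prod.snd).card = S.card := by
      refine Finset.card_image_of_injOn fun p hp q hq h => ?_
      exact Prod.ext ((hf p hp).trans (hf q hq).symm) h
    have mem : ∀ e, e ∈ S.image Prod.snd → (f, e) ∈ S := by
      intro e he
      obtain ⟨⟨f', e'⟩, hp, rfl⟩ := Finset.mem_image.1 he
      obtain rfl := hf _ hp
      exact hp
    obtain ⟨e₁, e₂, hne, l₁, l₂⟩ := hA (S.image Prod.snd) (by omega) (by omega)
    have key : ∀ a, IsLeaf A (S.image Prod.snd) a →
        IsLeaf (fun p : F × E => θ p.1 '' A p.2) S (f, a) := by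
      intro a la
      refine ⟨mem a la.1, ?_⟩
      rintro _ ⟨u, hu, rfl⟩ _ ⟨v, hv, rfl⟩ ⟨f₁, e₁⟩ h₁ ⟨f₂, e₂⟩ h₂ n₁ n₂ ⟨u', mu, eu⟩ ⟨v', mv, ev⟩
      have k₁ := hf _ h₁
      have k₂ := hf _ h₂
      simp only at k₁ k₂ hu hv mu mv eu ev
      subst f₁ f₂
      have := hθ _ eu
      have := hθ _ ev
      subst u' v'
      rw [la.2 u hu v hv e₁ (Finset.mem_image_of_mem _ h₁) e₂ (Finset.mem_image_of_mem _ h₂)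
        (fun h => n₁ (by rw [h])) (fun h => n₂ (by rw [h])) mu mv]
    exact ⟨_, _, fun h => hne (congrArg Prod.snd h), key _ l₁, key _ l₂⟩

/-! ### Sparse uniform hypergraphs by partite amalgamation. -/

/-- The hypergraph with edges `φ e : X ↪ V` has a monochromatic edge in every `C`-coloring. -/
def ForcesMonochromatic {X V E : Type} (C : Type) (φ : E → X ↪ V) : Prop :=
  ∀ χ : V → C, ∃ e k, ∀ x, χ (φ e x) = k

/-- Pigeonhole. It settles the complete hypergraph, and later finds a set of parts on which a
coloring of the parts is constant. -/
theorem exists_embedding_const {X ι C : Type} [Fintype X] [Fintype ι] [Fintype C]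
    (h : Fintype.card C * Fintype.card X < Fintype.card ι) (κ : ι → C) :
    ∃ (σ : X ↪ ι) (k : C), ∀ x, κ (σ x) = k := by
  classical
  obtain ⟨k, hk⟩ := Fintype.exists_lt_card_fiber_of_mul_lt_card κ h
  have : Fintype.card X ≤ Fintype.card {i // κ i = k} := by
    rw [Fintype.card_subtype]
    exact hk.le
  obtain ⟨σ⟩ := Function.Embedding.nonempty_of_card_le this
  exact ⟨σ.trans (Function.Embedding.subtype _), k, fun x => (σ x).2⟩

/-- Partite hypergraphs with parts indexed by `ι`, in which every coloring has transversal edges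
of all types `σ` on which the color depends only on the part, for the parts in `T`. -/
theorem exists_partite {X ι C : Type} [Finite X] [Finite ι] [Nonempty C] {g : ℕ}
    (ih : ∀ (Y : Type) [Finite Y], ∃ (V E : Type) (_ : Finite V) (_ : Finite E) (φ : E → Y ↪ V),
      LocallyForest g (fun e => Set.range (φ e)) ∧ ForcesMonochromatic C φ) (T : Finset ι) :
    ∃ (V E : Type) (_ : Finite V) (_ : Finite E) (φ : E → X ↪ V) (part : V → ι),
      LocallyForest (g + 1) (fun e => Set.range (φ e)) ∧
      (∀ e, Function.Injective fun x => part (φ e x)) ∧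
      ∀ χ : V → C, ∃ κ : ι → C, ∀ σ : X ↪ ι, ∃ e, ∀ x, part (φ e x) = σ x ∧
        (σ x ∈ T → χ (φ e x) = κ (σ x)) := by
  classical
  induction T using Finset.induction_on with
  | empty =>
    -- Pairwise disjoint edges, one of each type `σ`.
    refine ⟨(X ↪ ι) × X, X ↪ ι, inferInstance, inferInstance,
      fun σ => ⟨fun x => (σ, x), fun x y h => congrArg Prod.snd h⟩, fun p => p.1 p.2, ?_, ?_, ?_⟩
    · intro S h1 _
      have leaf : ∀ e ∈ S, IsLeaf (fun σ : X ↪ ι => Set.range fun x : X => (σ, x)) S e := by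
        refine fun e he => ⟨he, ?_⟩
        rintro _ ⟨x, rfl⟩ _ - e₁ - _ - n₁ - ⟨x₁, h₁⟩ -
        exact absurd (congrArg Prod.fst h₁) n₁
      obtain ⟨e₁, m₁, e₂, m₂, hne⟩ := Finset.one_lt_card.1 h1
      exact ⟨e₁, e₂, hne, leaf _ m₁, leaf _ m₂⟩
    · exact fun σ => σ.injective
    · exact fun χ => ⟨fun _ => Classical.arbitrary C, fun σ => ⟨σ, fun x => ⟨rfl, by simp⟩⟩⟩
  | insert i T _ hT =>
    obtain ⟨V, E, _, _, φ, part, hφ, hpart, hχ⟩ := hT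
    obtain ⟨W, F, _, _, ψ, hψ, hmono⟩ := ih {v : V // part v = i}
    -- In copy `f`, part `i` is identified with the hyperedge `ψ f`; everything else is kept
    -- disjoint.
    let θ : F → V → W ⊕ (F × V) := fun f v =>
      if h : part v = i then Sum.inl (ψ f ⟨v, h⟩) else Sum.inr (f, v)
    have hθ : ∀ f, Function.Injective (θ f) := by
      intro f u v h
      simp only [θ] at h
      split_ifs at h
      · simpa using h
      · simpa using h
    let part' : W ⊕ (F × V) → ι := Sum.elim (fun _ => i) fun p => part p.2
    have hp : ∀ f v, part' (θ f v) = part v := by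
      intro f v
      simp only [θ]
      split_ifs with h
      · exact h.symm
      · rfl
    refine ⟨W ⊕ (F × V), F × E, inferInstance, inferInstance,
      fun p => (φ p.2).trans ⟨θ p.1, hθ p.1⟩, part', ?_, ?_, ?_⟩
    · by_cases hW : Nonempty W
      · obtain ⟨w₀⟩ := hW
        let ψ' : F → V → W := fun f v => if h : part v = i then ψ f ⟨v, h⟩ else w₀
        have hψ' : ∀ f v (h : part v = i), ψ' f v = ψ f ⟨v, h⟩ := fun f v h => dif_pos h
        have himage : ∀ f, ψ' f '' {v | part v = i} = Set.range (ψ f) := by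
          intro f
          ext w
          constructor
          · rintro ⟨v, hv, rfl⟩
            exact ⟨⟨v, hv⟩, (hψ' f v hv).symm⟩
          · rintro ⟨⟨v, hv⟩, rfl⟩
            exact ⟨v, hv, hψ' f v hv⟩
        have := LocallyForest.amalgam (X := {v | part v = i}) (ψ := ψ') (θ := θ) (g := g)
          (A := fun e => Set.range (φ e)) ?_ hφ ?_ ?_ ?_ hθ
        · convert this using 2 with p
          exact Set.range_comp (θ p.1) (φ p.2)
        · rintro e _ ⟨x, rfl⟩ _ ⟨y, rfl⟩ hx hy
          rw [hpart e (hx.trans hy.symm : part (φ e x) = part (φ e y))]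
        · intro f u hu v hv h
          rw [hψ' f u hu, hψ' f v hv] at h
          exact congrArg Subtype.val ((ψ f).injective h)
        · simpa only [himage] using hψ
        · intro f f' u v hne h
          simp only [θ] at h
          split_ifs at h with hu hv
          · exact ⟨hu, hv, by rw [hψ' f u hu, hψ' f' v hv]; exact Sum.inl.inj h⟩
          · simp [hne] at h
      -- Without vertices in `W`, the copies have an empty part `i`, so they are disjoint.
      · have hnone : ∀ f v, part v ≠ i := fun f v h => hW ⟨ψ f ⟨v, h⟩⟩
        have := LocallyForest.amalgam (X := (∅ : Set V)) (ψ := fun (_ : F) v => v) (θ := θ) (g := g)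
          (A := fun e => Set.range (φ e)) (by simp) hφ (by simp) ?_ ?_ hθ
        · convert this using 2 with p
          exact Set.range_comp (θ p.1) (φ p.2)
        · intro S h1 _
          obtain ⟨e₁, m₁, e₂, m₂, hne⟩ := Finset.one_lt_card.1 h1
          exact ⟨e₁, e₂, hne, ⟨m₁, by simp⟩, ⟨m₂, by simp⟩⟩
        · intro f f' u v hne h
          simp only [θ, dif_neg (hnone f _), Sum.inr.injEq, Prod.mk.injEq] at h
          exact absurd h.1 hne
    · intro p
      simpa [hp] using hpart p.2
    · intro χ
      -- Some copy has a constant color `k` on part `i`; the induction hypothesis handles the parts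
      -- in `T` inside this copy.
      obtain ⟨f, k, hf⟩ := hmono fun w => χ (Sum.inl w)
      obtain ⟨κ, hκ⟩ := hχ fun v => χ (θ f v)
      refine ⟨Function.update κ i k, fun σ => ?_⟩
      obtain ⟨e, he⟩ := hκ σ
      refine ⟨(f, e), fun x => ⟨(hp _ _).trans (he x).1, fun hx => ?_⟩⟩
      change χ (θ f (φ e x)) = _
      by_cases hi : σ x = i
      · have h : part (φ e x) = i := (he x).1.trans hi
        rw [hi, Function.update_self]
        simp only [θ, dif_pos h]
        exact hf _
      · rw [Function.update_of_ne hi]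
        exact (he x).2 ((Finset.mem_insert.1 hx).resolve_left hi)

/-- Uniform hypergraphs of large girth and large chromatic number exist. -/
theorem exists_sparse_forcesMonochromatic (C : Type) [Finite C] [Nonempty C] (g : ℕ) :
    ∀ (X : Type) [Finite X], ∃ (V E : Type) (_ : Finite V) (_ : Finite E) (φ : E → X ↪ V),
      LocallyForest g (fun e => Set.range (φ e)) ∧ ForcesMonochromatic C φ := by
  classical
  induction g with
  | zero =>
    intro X _
    have := Fintype.ofFinite X
    have := Fintype.ofFinite C
    refine ⟨Fin (Fintype.card C * Fintype.card X + 1), X ↪ Fin _, inferInstance, inferInstance,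
      id, fun S _ h => absurd h (Nat.not_lt_zero _), fun χ => ?_⟩
    exact exists_embedding_const (by simp) χ
  | succ g ih =>
    intro X _
    have := Fintype.ofFinite X
    have := Fintype.ofFinite C
    obtain ⟨V, E, hV, hE, φ, part, hφ, -, hχ⟩ :=
      exists_partite (X := X) (ι := Fin (Fintype.card C * Fintype.card X + 1)) ih Finset.univ
    refine ⟨V, E, hV, hE, φ, hφ, fun χ => ?_⟩
    obtain ⟨κ, hκ⟩ := hχ χ
    obtain ⟨σ, k, hσ⟩ := exists_embedding_const (X := X) (by simp) κ
    obtain ⟨e, he⟩ := hκ σ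
    exact ⟨e, k, fun x => ((he x).2 (Finset.mem_univ _)).trans (hσ x)⟩

/-! ### Tools for the planar construction: order, coordinates, pendant edges. -/

/-- An injective map into a linear order can be rearranged to follow a given injective labelling
of its domain by natural numbers. -/
theorem exists_monotone_rearrangement {V W : Type} [Finite V] [LinearOrder W] {x : V → ℕ}
    (hx : Function.Injective x) (ψ : V ↪ W) :
    ∃ ψ' : V → W, Set.range ψ' = Set.range ψ ∧ ∀ u v, ψ' u ≤ ψ' v ↔ x u ≤ x v := by
  classical
  have := Fintype.ofFinite V
  let s : Finset ℕ := Finset.univ.image x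
  let t : Finset W := Finset.univ.image ψ
  have hs : s.card = Fintype.card V := Finset.card_image_of_injective _ hx
  have ht : t.card = Fintype.card V := Finset.card_image_of_injective _ ψ.injective
  let a : s ≃o t := (s.orderIsoOfFin hs).symm.trans (t.orderIsoOfFin ht)
  let b : V → s := fun v => ⟨x v, Finset.mem_image_of_mem _ (Finset.mem_univ v)⟩
  refine ⟨fun v => a (b v), ?_, fun u v => ?_⟩
  · ext w
    constructor
    · rintro ⟨v, rfl⟩
      obtain ⟨u, -, hu⟩ := Finset.mem_image.1 (a (b v)).2
      exact ⟨u, hu⟩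
    · rintro ⟨v, rfl⟩
      obtain ⟨u, -, hu⟩ := Finset.mem_image.1
        (a.symm ⟨ψ v, Finset.mem_image_of_mem _ (Finset.mem_univ v)⟩).2
      refine ⟨u, ?_⟩
      have : b u = a.symm ⟨ψ v, Finset.mem_image_of_mem _ (Finset.mem_univ v)⟩ := Subtype.ext hu
      simp only [this, OrderIso.apply_symm_apply]
  · rw [Subtype.coe_le_coe, a.le_iff_le]
    rfl

/-- Lexicographic comparison of quotient and remainder; both coordinates of the construction are
encoded this way. -/
theorem mul_add_le_mul_add_iff_of_lt {n a b r s : ℕ} (hr : r < n) (hs : s < n) :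
    n * a + r ≤ n * b + s ↔ a < b ∨ a = b ∧ r ≤ s := by
  rcases lt_trichotomy a b with h | rfl | h
  · have : n * (a + 1) ≤ n * b := Nat.mul_le_mul_left n h
    rw [Nat.mul_succ] at this
    simp only [h, true_or, iff_true]
    omega
  · simp
  · have : n * (b + 1) ≤ n * a := Nat.mul_le_mul_left n h
    rw [Nat.mul_succ] at this
    constructor
    · intro
      omega
    · omega

/-- It is enough to find a single leaf in every set of fewer than `g` edges. -/
theorem LocallyForest.of_exists_isLeaf {V E : Type} {g : ℕ} {A : E → Set V}
    (h : ∀ S : Finset E, S.Nonempty → S.card < g → ∃ e, IsLeaf A S e) : LocallyForest g A := by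
  classical
  intro S
  induction S using Finset.strongInduction with
  | H S ih =>
    intro h1 h2
    obtain ⟨e, he⟩ := h S (Finset.card_pos.1 (by omega)) h2
    have hcard := Finset.card_erase_of_mem he.1
    suffices ∃ e', e' ≠ e ∧ IsLeaf A S e' by
      obtain ⟨e', hne, hl⟩ := this
      exact ⟨e', e, hne, hl, he⟩
    rcases Nat.lt_or_ge 1 (S.erase e).card with h3 | h3
    · obtain ⟨e₁, e₂, hne, l₁, l₂⟩ := ih _ (Finset.erase_ssubset he.1) h3 (by omega)
      -- Putting back the leaf `e` spoils at most one leaf of `S.erase e`, since `e` meets the rest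
      -- in at most one vertex.
      have key : ∀ a, IsLeaf A (S.erase e) a → ¬ IsLeaf A S a →
          ∃ u ∈ A a, ∃ v ∈ A a, u ≠ v ∧ (∃ b ∈ S.erase e, b ≠ a ∧ u ∈ A b) ∧ v ∈ A e := by
        intro a la nl
        by_contra hcon
        refine nl ⟨Finset.mem_of_mem_erase la.1, ?_⟩
        intro u hu v hv b hb d hd nb nd ub vd
        by_contra huv
        have ha := Finset.ne_of_mem_erase la.1
        by_cases kb : b = e <;> by_cases kd : d = e
        · subst kb
          subst kd
          have ma := Finset.mem_of_mem_erase la.1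
          exact huv (he.2 u ub v vd a ma a ma ha ha hu hv)
        · subst kb
          exact hcon ⟨v, hv, u, hu, Ne.symm huv, ⟨d, Finset.mem_erase.2 ⟨kd, hd⟩, nd, vd⟩, ub⟩
        · subst kd
          exact hcon ⟨u, hu, v, hv, huv, ⟨b, Finset.mem_erase.2 ⟨kb, hb⟩, nb, ub⟩, vd⟩
        · exact huv (la.2 u hu v hv b (Finset.mem_erase.2 ⟨kb, hb⟩) d (Finset.mem_erase.2 ⟨kd, hd⟩)
            nb nd ub vd)
      by_contra hno
      push Not at hno
      have n₁ := Finset.ne_of_mem_erase l₁.1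
      have n₂ := Finset.ne_of_mem_erase l₂.1
      obtain ⟨u, hu, v, hv, huv, ⟨b, hb, hba, hub⟩, hve⟩ := key e₁ l₁ (hno e₁ n₁)
      obtain ⟨-, -, w, hw, -, -, hwe⟩ := key e₂ l₂ (hno e₂ n₂)
      obtain rfl := he.2 v hve w hwe e₁ (Finset.mem_of_mem_erase l₁.1) e₂
        (Finset.mem_of_mem_erase l₂.1) n₁ n₂ hv hw
      exact huv (l₁.2 u hu v hv b hb e₂ l₂.1 hba hne.symm hub hw)
    · obtain ⟨a, ha⟩ := Finset.card_eq_one.1 (by omega : (S.erase e).card = 1)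
      have ma : a ∈ S.erase e := by simp [ha]
      obtain ⟨nae, mS⟩ := Finset.mem_erase.1 ma
      have only : ∀ b ∈ S, b ≠ a → b = e := by
        intro b hb hba
        by_contra hbe
        have : b ∈ S.erase e := Finset.mem_erase.2 ⟨hbe, hb⟩
        rw [ha] at this
        exact hba (Finset.mem_singleton.1 this)
      refine ⟨a, nae, mS, fun u hu v hv b hb d hd nb nd ub vd => ?_⟩
      rw [only b hb nb] at ub
      rw [only d hd nd] at vd
      exact he.2 u ub v vd a mS a mS nae nae hu hv

/-- Attaching a pendant edge to every vertex keeps the sparsity. -/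
theorem LocallyForest.pendant {V E : Type} {g : ℕ} {A : E → Set V} (hA : LocallyForest g A) :
    LocallyForest g (Sum.elim (fun e => Sum.inr '' A e)
      (fun v => {Sum.inl v, Sum.inr v}) : E ⊕ V → Set (V ⊕ V)) := by
  classical
  refine LocallyForest.of_exists_isLeaf fun S h1 h2 => ?_
  set B : E ⊕ V → Set (V ⊕ V) := Sum.elim (fun e => Sum.inr '' A e) (fun v => {Sum.inl v, Sum.inr v})
    with hB
  by_cases hv : ∃ v, Sum.inr v ∈ S
  · obtain ⟨v, hv⟩ := hv
    -- A pendant edge is always a leaf: its end `Sum.inl v` lies on no other edge.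
    have key : ∀ e ≠ Sum.inr v, ∀ u ∈ B (Sum.inr v), u ∈ B e → u = Sum.inr v := by
      rintro (e | w) hne u hu hu'
      · rcases hu with rfl | rfl
        · obtain ⟨a, -, h⟩ := hu'
          exact absurd h (by simp)
        · rfl
      · rcases hu with rfl | rfl
        · rcases hu' with h | h
          · exact absurd (congrArg Sum.inr (Sum.inl.inj h)).symm hne
          · exact absurd h (by simp)
        · rfl
    exact ⟨Sum.inr v, hv, fun u hu w hw e₁ _ e₂ _ n₁ n₂ k₁ k₂ =>
      (key e₁ n₁ u hu k₁).trans (key e₂ n₂ w hw k₂).symm⟩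
  · have left : ∀ p ∈ S, ∃ e, p = Sum.inl e := by
      rintro (e | v) hp
      · exact ⟨e, rfl⟩
      · exact absurd ⟨v, hp⟩ hv
    have hleaf : ∃ e, Sum.inl e ∈ S ∧ ∀ u ∈ A e, ∀ v ∈ A e, ∀ e₁, Sum.inl e₁ ∈ S →
        ∀ e₂, Sum.inl e₂ ∈ S → e₁ ≠ e → e₂ ≠ e → u ∈ A e₁ → v ∈ A e₂ → u = v := by
      have hle : S.toLeft.card ≤ S.card := by
        rw [← S.card_toLeft_add_card_toRight]
        omega
      obtain ⟨p, hp⟩ := h1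
      obtain ⟨e, rfl⟩ := left p hp
      rcases Nat.lt_or_ge 1 S.toLeft.card with h3 | h3
      · obtain ⟨e₁, -, -, l, -⟩ := hA S.toLeft h3 (by omega)
        simp only [IsLeaf, Finset.mem_toLeft] at l
        exact ⟨e₁, l⟩
      · refine ⟨e, hp, fun u _ v _ e₁ h₁ _ _ n₁ _ _ _ => ?_⟩
        exact absurd (Finset.card_le_one.1 h3 _ (Finset.mem_toLeft.2 h₁) _
          (Finset.mem_toLeft.2 hp)) n₁
    obtain ⟨e, he, hl⟩ := hleaf
    refine ⟨Sum.inl e, he, ?_⟩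
    rintro _ ⟨u, hu, rfl⟩ _ ⟨v, hv, rfl⟩ p₁ h₁ p₂ h₂ n₁ n₂ k₁ k₂
    obtain ⟨e₁, rfl⟩ := left p₁ h₁
    obtain ⟨e₂, rfl⟩ := left p₂ h₂
    obtain ⟨u', mu, eu⟩ := k₁
    obtain ⟨v', mv, ev⟩ := k₂
    obtain rfl := Sum.inr.inj eu
    obtain rfl := Sum.inr.inj ev
    rw [hl _ hu _ hv e₁ h₁ e₂ h₂ (fun h => n₁ (by rw [h])) (fun h => n₂ (by rw [h])) mu mv]

/-! ### The planar construction. -/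

/-- Points with natural coordinates and a graph of large girth on them that is not `c`-colorable,
such that the bounding rectangle of every edge contains no further point. -/
theorem exists_rectangle_graph (c g : ℕ) :
    ∃ (V E : Type) (_ : Finite V) (s t : E → V) (x y : V → ℕ), Function.Injective x ∧
      (∀ e, s e ≠ t e) ∧
      (∀ e v, x v ∈ Set.uIcc (x (s e)) (x (t e)) → y v ∈ Set.uIcc (y (s e)) (y (t e)) →
        v = s e ∨ v = t e) ∧
      LocallyForest (g + 1) (fun e => {s e, t e}) ∧
      ∀ χ : V → Fin c, ∃ e, χ (s e) = χ (t e) := by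
  classical
  induction c with
  | zero =>
    refine ⟨Unit, Empty, inferInstance, Empty.elim, Empty.elim, fun _ => 0, fun _ => 0,
      fun _ _ _ => rfl, fun e => e.elim, fun e => e.elim, ?_, fun χ => (χ ()).elim0⟩
    intro S h
    rw [Finset.eq_empty_of_isEmpty S] at h
    exact absurd h (by simp)
  | succ c ih =>
    obtain ⟨V, E, _, s, t, x, y, hx, hst, hempty, hA, hχ⟩ := ih
    obtain ⟨W₀, F₀, _, _, φ, hφ, hmono⟩ := exists_sparse_forcesMonochromatic (Fin (c + 1)) g V
    obtain ⟨M, ⟨iW⟩⟩ := Finite.exists_equiv_fin W₀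
    obtain ⟨L, ⟨iF⟩⟩ := Finite.exists_equiv_fin F₀
    obtain ⟨B, hB⟩ : ∃ B, ∀ v, y v < B := by
      obtain ⟨b, hb⟩ := (Set.finite_range y).bddAbove
      exact ⟨b + 1, fun v => Nat.lt_succ_of_le (hb ⟨v, rfl⟩)⟩
    let r : F₀ → ℕ := fun f => (iF f : ℕ)
    have hr : ∀ f, r f < L := fun f => (iF f).2
    have hr' : Function.Injective r := Fin.val_injective.comp iF.injective
    have hψ : ∀ f, ∃ ψ : V → Fin M, Set.range ψ = iW '' Set.range (φ f) ∧
        ∀ u v, ψ u ≤ ψ v ↔ x u ≤ x v := by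
      intro f
      obtain ⟨ψ, h1, h2⟩ := exists_monotone_rearrangement hx ((φ f).trans iW.toEmbedding)
      refine ⟨ψ, h1.trans ?_, h2⟩
      rw [← Set.range_comp]
      rfl
    choose ψ hψr hψm using hψ
    have hψi : ∀ f, Function.Injective (ψ f) := fun f u v h =>
      hx (le_antisymm ((hψm f u v).1 h.le) ((hψm f v u).1 h.ge))
    have hval : ∀ f u v, (ψ f u : ℕ) ≤ ψ f v ↔ x u ≤ x v := hψm
    have hH : LocallyForest g (fun f => Set.range (ψ f)) := by
      intro S h1 h2
      obtain ⟨e₁, e₂, hne, l₁, l₂⟩ := hφ S h1 h2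
      have key : ∀ e, IsLeaf (fun e => Set.range (φ e)) S e → IsLeaf (fun f => Set.range (ψ f)) S e := by
        intro e l
        refine ⟨l.1, ?_⟩
        simp only [hψr]
        rintro _ ⟨u, hu, rfl⟩ _ ⟨v, hv, rfl⟩ a ha b hb na nb ⟨u', hu', eu⟩ ⟨v', hv', ev⟩
        obtain rfl := iW.injective eu
        obtain rfl := iW.injective ev
        rw [l.2 _ hu _ hv a ha b hb na nb hu' hv']
      exact ⟨e₁, e₂, hne, key _ l₁, key _ l₂⟩
    -- Each base point starts a column of width `L + 1`. The offset `L - r f` is positive and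
    -- decreases with the height of the copy, so lower copies lie to the right of a pendant edge's
    -- box.
    let x' : Fin M ⊕ (F₀ × V) → ℕ := Sum.elim (fun w => (L + 1) * w + 0)
      (fun p => (L + 1) * (ψ p.1 p.2 : ℕ) + (L - r p.1))
    -- Height blocks of length `B` separate the copies; the `+ 1` keeps them above the base line.
    let y' : Fin M ⊕ (F₀ × V) → ℕ := Sum.elim (fun _ => 0) (fun p => B * (r p.1 + 1) + y p.2)
    let s' : F₀ × (E ⊕ V) → Fin M ⊕ (F₀ × V) := fun p =>
      Sum.elim (fun e => Sum.inr (p.1, s e)) (fun v => Sum.inl (ψ p.1 v)) p.2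
    let t' : F₀ × (E ⊕ V) → Fin M ⊕ (F₀ × V) := fun p =>
      Sum.elim (fun e => Sum.inr (p.1, t e)) (fun v => Sum.inr (p.1, v)) p.2
    have hL : ∀ f, L - r f < L + 1 := fun f => by omega
    have hLpos : ∀ f, 0 < L - r f := fun f => Nat.sub_pos_of_lt (hr f)
    refine ⟨Fin M ⊕ (F₀ × V), F₀ × (E ⊕ V), inferInstance, s', t', x', y', ?_, ?_, ?_, ?_, ?_⟩
    · have lex : ∀ a b p q, p < L + 1 → q < L + 1 → (L + 1) * a + p = (L + 1) * b + q →
          a = b ∧ p = q := by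
        intro a b p q hp hq h
        have h1 := (mul_add_le_mul_add_iff_of_lt hp hq).1 h.le
        have h2 := (mul_add_le_mul_add_iff_of_lt hq hp).1 h.ge
        omega
      rintro (w | ⟨f, v⟩) (w' | ⟨f', v'⟩) h
      · rw [Fin.ext (lex _ _ _ _ L.succ_pos L.succ_pos h).1]
      · have := (lex _ _ _ _ L.succ_pos (hL f') h).2
        have := hLpos f'
        omega
      · have := (lex _ _ _ _ (hL f) L.succ_pos h).2
        have := hLpos f
        omega
      · obtain ⟨h1, h2⟩ := lex _ _ _ _ (hL f) (hL f') h
        have k1 := hr f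
        have k2 := hr f'
        obtain rfl : f = f' := hr' (by change L - r f = L - r f' at h2; omega)
        exact congrArg (fun v => Sum.inr (f, v)) (hψi f (Fin.ext h1))
    · rintro ⟨f, e | v⟩
      · simpa [s', t'] using hst e
      · simp [s', t']
    · rintro ⟨f, e | v⟩ (w | ⟨f', v'⟩) h1 h2
      · exfalso
        have : 0 < B := (Nat.zero_le _).trans_lt (hB (s e))
        have : 0 < B * (r f + 1) := Nat.mul_pos this (Nat.succ_pos _)
        simp only [s', t', y', Sum.elim_inl, Sum.elim_inr, Set.mem_uIcc] at h2
        omega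
      · simp only [s', t', y', x', Sum.elim_inl, Sum.elim_inr, Set.mem_uIcc,
          mul_add_le_mul_add_iff_of_lt (hB _) (hB _)] at h1 h2
        obtain rfl : f = f' := hr' (by omega)
        simp only [mul_add_le_mul_add_iff_of_lt (hL _) (hL _)] at h1
        have := hempty e v' (by
          simp only [Set.mem_uIcc, ← hval f]
          omega) (by
          simp only [Set.mem_uIcc]
          omega)
        simpa [s', t'] using this
      · left
        simp only [s', t', x', Sum.elim_inl, Sum.elim_inr, Set.mem_uIcc,
          mul_add_le_mul_add_iff_of_lt (hL _) L.succ_pos,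
          mul_add_le_mul_add_iff_of_lt L.succ_pos (hL _),
          mul_add_le_mul_add_iff_of_lt L.succ_pos L.succ_pos] at h1 ⊢
        have := hLpos f
        exact congrArg Sum.inl (Fin.ext (by omega))
      -- Abscissas force the same column and `r f ≤ r f'`; heights force `r f' ≤ r f`.
      · right
        simp only [s', t', y', x', Sum.elim_inl, Sum.elim_inr, Set.mem_uIcc,
          mul_add_le_mul_add_iff_of_lt (hB _) (hB _),
          mul_add_le_mul_add_iff_of_lt (hL _) (hL _),
          mul_add_le_mul_add_iff_of_lt (hL _) L.succ_pos,
          mul_add_le_mul_add_iff_of_lt L.succ_pos (hL _)] at h1 h2 ⊢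
        have k1 := hr f
        have k2 := hr f'
        have k3 : 0 < B := (Nat.zero_le _).trans_lt (hB v)
        have k4 : 0 < B * (r f' + 1) := Nat.mul_pos k3 (Nat.succ_pos _)
        obtain rfl : f = f' := hr' (by omega)
        rw [hψi f (Fin.ext (by omega) : ψ f v' = ψ f v)]
    · have := LocallyForest.amalgam (X := Set.range (Sum.inl : V → V ⊕ V)) (g := g)
        (ψ := fun f => Sum.elim (ψ f) (ψ f)) (θ := fun f => Sum.map (ψ f) (fun v => (f, v)))
        ?_ hA.pendant ?_ ?_ ?_ ?_
      · convert this using 2 with p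
        obtain ⟨f, e | v⟩ := p
        · simp [s', t', Set.image_pair]
        · simp [s', t', Set.image_pair]
      · rintro (e | v) a ha b hb ⟨u, rfl⟩ ⟨w, rfl⟩
        · obtain ⟨_, -, h⟩ := ha
          exact absurd h (by simp)
        · simp only [Sum.elim_inr, Set.mem_insert_iff, Sum.inl.injEq, Set.mem_singleton_iff,
            reduceCtorEq, or_false] at ha hb
          rw [ha, hb]
      · rintro f _ ⟨u, rfl⟩ _ ⟨v, rfl⟩ h
        rw [hψi f h]
      · simpa only [← Set.range_comp, Function.comp_def, Sum.elim_inl] using hH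
      · rintro f f' (u | u) (v | v) hne h
        · exact ⟨⟨u, rfl⟩, ⟨v, rfl⟩, Sum.inl.inj h⟩
        · simp at h
        · simp at h
        · simp [hne] at h
      · exact fun f => Function.Injective.sumMap (hψi f) fun u v h => congrArg Prod.snd h
    · intro χ
      obtain ⟨f, k, hf⟩ := hmono fun w => χ (Sum.inl (iW w))
      have hk : ∀ v, χ (Sum.inl (ψ f v)) = k := by
        intro v
        obtain ⟨_, ⟨u, rfl⟩, hu⟩ : ψ f v ∈ iW '' Set.range (φ f) := hψr f ▸ ⟨v, rfl⟩
        rw [← hu]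
        exact hf u
      by_cases hv : ∃ v, χ (Sum.inr (f, v)) = k
      · obtain ⟨v, hv⟩ := hv
        exact ⟨(f, Sum.inr v), (hk v).trans hv.symm⟩
      · push Not at hv
        -- Color `k` is missing on the copy, so deleting it from the palette leaves a `c`-coloring.
        choose χ' hsucc using fun v => Fin.exists_succAbove_eq (hv v)
        obtain ⟨e, he⟩ := hχ χ'
        refine ⟨(f, Sum.inl e), ?_⟩
        change χ (Sum.inr (f, s e)) = χ (Sum.inr (f, t e))
        rw [← hsucc, ← hsucc, he]

/-! ### From leaves to girth, and the conclusion. -/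

/-- Cycles of a hypergraph whose edges are the injective images of a locally forest-like
family are long. -/
theorem LocallyForest.le_girth {α V E : Type} {g : ℕ} {A : E → Set V} (hA : LocallyForest g A)
    {p : V → α} (hp : Function.Injective p) {H : Hypergraph α}
    (hH : ∀ a ∈ H.edgeSet, ∃ e, a = p '' A e) : (g : ℕ∞) ≤ H.girth := by
  classical
  refine le_iInf fun n => le_iInf fun v => le_iInf fun D => le_iInf fun hD => ?_
  rw [Nat.cast_le]
  by_contra! hn
  choose e he using fun i => hH _ (hD.edge_mem i)
  have hinj : Function.Injective e := fun i j h => hD.edge_injective (by rw [he, he, h])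
  choose a ha hav using fun i => he i ▸ hD.mem_edge i
  have hnext : ∀ i, a (finRotate n i) ∈ A (e i) := by
    intro i
    obtain ⟨b, hb, hbv⟩ := he i ▸ hD.next_mem_edge i
    rwa [hp (hbv.trans (hav _).symm)] at hb
  have hrot : ∀ i, finRotate n i ≠ i := by
    obtain ⟨m, rfl⟩ : ∃ m, n = m + 2 := ⟨n - 2, by have := hD.two_le; omega⟩
    intro i h
    rw [finRotate_apply] at h
    simp at h
  have hcard : (Finset.univ.image e).card = n := by
    rw [Finset.card_image_of_injective _ hinj, Finset.card_univ, Fintype.card_fin]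
  obtain ⟨e₁, -, -, l, -⟩ := hA (Finset.univ.image e) (by rw [hcard]; exact hD.two_le)
    (by rw [hcard]; exact hn)
  obtain ⟨i, -, rfl⟩ := Finset.mem_image.1 l.1
  obtain ⟨j, rfl⟩ := (finRotate n).surjective i
  -- The leaf shares its two cycle vertices with the preceding and the following edge; these
  -- coincide when `n = 2`, which the notion of leaf permits.
  have h := l.2 _ (ha _) _ (hnext _) (e j) (Finset.mem_image_of_mem _ (Finset.mem_univ _))
    (e (finRotate n (finRotate n j))) (Finset.mem_image_of_mem _ (Finset.mem_univ _))
    (fun h => hrot j (hinj h).symm) (fun h => hrot _ (hinj h)) (hnext j) (ha _)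
  refine hrot (finRotate n j) (hD.vertex_injective ?_)
  rw [← hav, ← hav, h]

theorem theorem3 (c g : ℕ) (hc : 1 ≤ c) (hg : 1 ≤ g) :
    ∃ (P : Set (ℝ × ℝ)) (R : Set (Set (ℝ × ℝ))),
      P.Finite ∧ (∀ r ∈ R, IsAxisParallelRectangle r) ∧
      (Hypergraph.incidence P R).IsGraph ∧
      (g : ℕ∞) ≤ (Hypergraph.incidence P R).girth ∧
      ((c + 1 : ℕ) : ℕ∞) ≤ (Hypergraph.incidence P R).chromaticNumber := by
  obtain ⟨g, rfl⟩ : ∃ k, g = k + 1 := ⟨g - 1, by omega⟩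
  obtain ⟨V, E, _, s, t, x, y, hx, hst, hempty, hA, hχ⟩ := exists_rectangle_graph c g
  let p : V → ℝ × ℝ := fun v => (x v, y v)
  have hp : Function.Injective p := fun u v h => hx (Nat.cast_injective (congrArg Prod.fst h))
  let rect : E → Set (ℝ × ℝ) := fun e => {q | (min (x (s e)) (x (t e)) : ℕ) ≤ q.1 ∧
    q.1 ≤ (max (x (s e)) (x (t e)) : ℕ) ∧ (min (y (s e)) (y (t e)) : ℕ) ≤ q.2 ∧
    q.2 ≤ (max (y (s e)) (y (t e)) : ℕ)}
  have htrace : ∀ e, Set.range p ∩ rect e = p '' {s e, t e} := by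
    intro e
    ext q
    constructor
    · rintro ⟨⟨v, rfl⟩, h1, h2, h3, h4⟩
      exact ⟨v, hempty e v ⟨Nat.cast_le.1 h1, Nat.cast_le.1 h2⟩
        ⟨Nat.cast_le.1 h3, Nat.cast_le.1 h4⟩, rfl⟩
    · rintro ⟨v, hv, rfl⟩
      refine ⟨⟨v, rfl⟩, ?_⟩
      rcases hv with rfl | rfl
      · exact ⟨Nat.cast_le.2 (min_le_left _ _), Nat.cast_le.2 (le_max_left _ _),
          Nat.cast_le.2 (min_le_left _ _), Nat.cast_le.2 (le_max_left _ _)⟩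
      · exact ⟨Nat.cast_le.2 (min_le_right _ _), Nat.cast_le.2 (le_max_right _ _),
          Nat.cast_le.2 (min_le_right _ _), Nat.cast_le.2 (le_max_right _ _)⟩
  have hedge : ∀ a ∈ (Hypergraph.incidence (Set.range p) (Set.range rect)).edgeSet,
      ∃ e, a = p '' {s e, t e} := by
    rintro a ⟨_, ⟨e, rfl⟩, rfl⟩
    exact ⟨e, htrace e⟩
  refine ⟨Set.range p, Set.range rect, Set.finite_range p, ?_, ?_, hA.le_girth hp hedge, ?_⟩
  · rintro _ ⟨e, rfl⟩
    exact ⟨_, _, _, _, rfl⟩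
  · intro a ha
    obtain ⟨e, rfl⟩ := hedge a ha
    rw [Set.ncard_image_of_injective _ hp, Set.ncard_pair (hst e)]
  · refine le_iInf fun n => le_iInf fun ⟨f, hf⟩ => ?_
    rw [Nat.cast_le]
    by_contra! hn
    -- A coloring with `n ≤ c` colors is read as one with `c` colors.
    obtain ⟨e, he⟩ := hχ fun v => Fin.castLE (Nat.lt_succ_iff.1 hn) (f ⟨p v, v, rfl⟩)
    have he' := Fin.castLE_injective _ he
    refine hf _ ⟨rect e, ⟨e, rfl⟩, rfl⟩ ?_
    have key : ∀ u : (Hypergraph.incidence (Set.range p) (Set.range rect)).vertexSet,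
        (u : ℝ × ℝ) ∈ Set.range p ∩ rect e → f u = f ⟨p (s e), s e, rfl⟩ := by
      rintro ⟨u, hu⟩ hmem
      rw [htrace] at hmem
      obtain ⟨v, rfl | rfl, rfl⟩ := hmem
      · rfl
      · exact he'.symm
    exact fun u v hu hv => (key u hu).trans (key v hv).symm
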